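/- Let $\mathcal{H}$ be a real Hilbert space, let $m\ge 1$ be an integer, and let $D$ be a nonempty weakly sequentially closed subset of $\mathcal{H}$ (i.e. $D$ contains the weak limit of every weakly convergent sequence of its points). For $i=1,\dots,m$ let $T_i : D\to\mathcal{H}$ be isometric, i.e. $\|T_ix-T_iy\|=\|x-y\|$ for all $x,y\in D$, and put $\operatorname{Fix}T_i=\{x\in D : T_ix=x\}$. Assume $F:=\bigcap_{i=1}^m \operatorname{Fix}T_i\neq\varnothing$. Let $\mathcal{S}$ be either $\{\mathrm{Id},T_1,\dots,T_m\}$ or $\{\mathrm{Id},T_1,T_2T_1,\dots,T_m\cdots T_2T_1\}$; in the second case the compositions are assumed to be defined on $D$, i.e. $T_k\cdots T_1(D)\subseteq D$ for $1\le k<m$. For $x\in D$ let $\mathcal{S}(x)=\{Gx : G\in\mathcal{S}\}$ and let $CC_{\mathcal{S}}x$ be the circumcenter of $\mathcal{S}(x)$, i.e. the unique point of the affine hull of $\mathcal{S}(x)$ that is equidistant from all points of $\mathcal{S}(x)$, if such a point exists. Assume that for every $x\in D$ the point $CC_{\mathcal{S}}x$ exists and lies in $D$. Write $P_F u$ for the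 unique point of $F$ nearest to $u$, when there is exactly one. Let $x\in D$. Then $P_Fx$ exists, and: (i) for every integer $k\ge 1$, $P_F(CC_{\mathcal{S}}^kx)$ exists and $P_F(CC_{\mathcal{S}}^kx)=P_Fx$, and the sequence $(CC_{\mathcal{S}}^kx)_{k\in\mathbb{N}}$ converges weakly to $P_Fx$; (ii) if $\limsup_{k\to\infty}\|CC_{\mathcal{S}}^kx\|\le\|P_Fx\|$, or if $\mathcal{H}$ is finite-dimensional (e.g. $\mathcal{H}=\mathbb{R}^n$), then $(CC_{\mathcal{S}}^kx)_{k\in\mathbb{N}}$ converges in norm to $P_Fx$. -/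

import Mathlib

open Filter Topology

namespace CircumcenterMethod

variable {H : Type*} [NormedAddCommGroup H] [InnerProductSpace ℝ H]

/-- Weak convergence of a sequence: `⟪xₖ, v⟫ → ⟪p, v⟫` for every `v`. -/
def WeaklyConvergesTo (x : ℕ → H) (p : H) : Prop :=
  ∀ v : H, Tendsto (fun k => inner ℝ (x k) v) atTop (𝓝 (inner ℝ p v))

/-- `D` contains the weak limit of every weakly convergent sequence in `D`. -/
def IsWeaklySeqClosed (D : Set H) : Prop :=
  ∀ (x : ℕ → H) (p : H), (∀ k, x k ∈ D) → WeaklyConvergesTo x p → p ∈ D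

/-- An operator `T : D → H` is represented by a map on `H` of which only the values on `D` matter;
it is isometric when it preserves the distances between points of `D`. -/
def IsIsometricOn (D : Set H) (T : H → H) : Prop :=
  ∀ x ∈ D, ∀ y ∈ D, ‖T x - T y‖ = ‖x - y‖

/-- The set of fixed points of `T : D → H`. -/
def fixSet (D : Set H) (T : H → H) : Set H := {x | x ∈ D ∧ T x = x}

/-- `T₁, …, Tₘ` composed: `composition T k = Tₖ ⋯ T₂ T₁`, and `Id` for `k = 0`. -/
def composition (T : ℕ → H → H) : ℕ → H → H
  | 0 => id
  | k + 1 => T (k + 1) ∘ composition T k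

/-- The set of operators `{Id, T₁, …, Tₘ}`. -/
def opsSimple (T : ℕ → H → H) (m : ℕ) : Set (H → H) :=
  {F | F = id ∨ ∃ i, 1 ≤ i ∧ i ≤ m ∧ F = T i}

/-- The set of operators `{Id, T₁, T₂T₁, …, Tₘ⋯T₂T₁}`. -/
def opsComposed (T : ℕ → H → H) (m : ℕ) : Set (H → H) :=
  {F | F = id ∨ ∃ k, 1 ≤ k ∧ k ≤ m ∧ F = composition T k}

/-- The compositions `T₁, T₂T₁, …, Tₘ⋯T₂T₁` of the operators `Tᵢ : D → H` are defined on `D`,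
that is, each `Tₖ⋯T₁` with `k < m` takes values in the domain `D` of the next operator. -/
def CompositionsDefinedOn (D : Set H) (T : ℕ → H → H) (m : ℕ) : Prop :=
  ∀ k, 1 ≤ k → k < m → ∀ x ∈ D, composition T k x ∈ D

/-- `p` lies in the affine hull of `K` and is equidistant from all points of `K`. -/
def IsCircumcenter (K : Set H) (p : H) : Prop :=
  p ∈ affineSpan ℝ K ∧ ∃ r : ℝ, (fun x => ‖p - x‖) '' K = {r}

theorem IsCircumcenter.unique {K : Set H} {p q : H}
    (hp : IsCircumcenter K p) (hq : IsCircumcenter K q) : p = q := by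
  obtain ⟨hpK, r, hr⟩ := hp
  obtain ⟨hqK, s, hs⟩ := hq
  have hp' : ∀ x ∈ K, ‖p - x‖ = r := fun x hx => by
    have : ‖p - x‖ ∈ (fun x => ‖p - x‖) '' K := ⟨x, hx, rfl⟩
    rwa [hr] at this
  have hq' : ∀ x ∈ K, ‖q - x‖ = s := fun x hx => by
    have : ‖q - x‖ ∈ (fun x => ‖q - x‖) '' K := ⟨x, hx, rfl⟩
    rwa [hs] at this
  have key : ∀ x ∈ K, ∀ y ∈ K, inner ℝ (p - q) (x - y) = 0 := by
    intro x hx y hy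
    have h1 : ‖p - x‖ ^ 2 = ‖p - y‖ ^ 2 := by rw [hp' x hx, hp' y hy]
    have h2 : ‖q - x‖ ^ 2 = ‖q - y‖ ^ 2 := by rw [hq' x hx, hq' y hy]
    simp only [norm_sub_sq_real] at h1 h2
    simp only [inner_sub_left, inner_sub_right]
    linarith
  have hmem : p - q ∈ vectorSpan ℝ K := by
    have := AffineSubspace.vsub_mem_direction hpK hqK
    rwa [direction_affineSpan] at this
  have hall : ∀ v ∈ vectorSpan ℝ K, inner ℝ (p - q) v = 0 := by
    intro v hv
    unfold vectorSpan at hv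
    induction hv using Submodule.span_induction with
    | mem v hv => obtain ⟨x, hx, y, hy, rfl⟩ := hv; exact key x hx y hy
    | zero => simp
    | add a b _ _ ha hb => rw [inner_add_right, ha, hb, add_zero]
    | smul c a _ ha => rw [inner_smul_right, ha, mul_zero]
  exact sub_eq_zero.mp (inner_self_eq_zero.mp (hall _ hmem))

open Classical in
/-- The circumcenter operator; `none` means that the circumcenter does not exist. -/
noncomputable def circumcenter (K : Set H) : Option H :=
  if h : ∃ p, IsCircumcenter K p then some h.choose else none

theorem circumcenter_eq_some_iff {K : Set H} {p : H} :
    circumcenter K = some p ↔ IsCircumcenter K p := by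
  unfold circumcenter
  constructor
  · intro h
    split_ifs at h with h'
    rw [Option.some.injEq] at h
    exact h ▸ h'.choose_spec
  · intro h
    have h' : ∃ p, IsCircumcenter K p := ⟨p, h⟩
    rw [dif_pos h']
    exact congrArg some (h'.choose_spec.unique h)

/-- The circumcenter mapping induced by `S`: the circumcenter of `S(x) = {F x | F ∈ S}`. -/
noncomputable def circumcenterMap (S : Set (H → H)) (x : H) : Option H :=
  circumcenter ((fun F => F x) '' S)

/-- The circumcenter mapping is proper over `D`: at each point of `D` it exists and lies in `D`. -/
def IsProperOver (S : Set (H → H)) (D : Set H) : Prop :=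
  ∀ x ∈ D, ∃ y ∈ D, circumcenterMap S x = some y

/-- The circumcenter mapping as a map `D → D`, when it is proper over `D`. -/
noncomputable def IsProperOver.selfMap {S : Set (H → H)} {D : Set H} (h : IsProperOver S D) :
    D → D :=
  fun x => ⟨(h x x.2).choose, (h x x.2).choose_spec.1⟩

theorem IsProperOver.selfMap_spec {S : Set (H → H)} {D : Set H} (h : IsProperOver S D) (x : D) :
    circumcenterMap S x = some (h.selfMap x : H) :=
  (h x x.2).choose_spec.2

/-- `p = P_C x`: the point `p` is the one and only point of `C` nearest to `x`. -/
def IsProjection (C : Set H) (x p : H) : Prop :=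
  p ∈ C ∧ ∀ y ∈ C, y ≠ p → ‖x - p‖ < ‖x - y‖

end CircumcenterMethod

/-! ### Weak compactness and demiclosedness -/

namespace CircumcenterMethod

/-! Write `y k` for the iterates. Every `z ∈ F` is equidistant from the points of `S (y k)`, so `y
(k + 1)` is the orthogonal projection of every such `z` onto the affine hull of `S (y k)`, which
contains `y k`. Two consequences follow. By Pythagoras, the distance to each `z` is nonincreasing
and the steps tend to zero. As `Id ∈ S`, the step length is the circumradius, so each `T i` moves `y
k` by an amount tending to zero, and demiclosedness puts every weak cluster point in `F`.
Subtracting the orthogonality relations for `z, w ∈ F` shows that `⟪y k, z - w⟫` does not depend on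
`k`. Hence for a weak cluster point `p` every `y k - p` is orthogonal to `F - p`. This makes `p` the
projection of all iterates and the only cluster point, without any convexity of `D` or `F`. -/

/-- A bounded sequence in a Hilbert space has a weakly convergent subsequence. -/
theorem exists_subseq_weaklyConvergesTo {H : Type*} [NormedAddCommGroup H]
    [InnerProductSpace ℝ H] [CompleteSpace H] (x : ℕ → H) (C : ℝ) (hC : ∀ k, ‖x k‖ ≤ C) :
    ∃ (p : H) (φ : ℕ → ℕ), StrictMono φ ∧ WeaklyConvergesTo (x ∘ φ) p := by
  -- The closed span of the sequence is separable, so sequential Banach–Alaoglu applies in its dual,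
  -- identified with `V` by Riesz.
  set V : Submodule ℝ H := (Submodule.span ℝ (Set.range x)).topologicalClosure with hV
  have hxV : ∀ k, x k ∈ V := fun k =>
    Submodule.le_topologicalClosure _ (Submodule.subset_span ⟨k, rfl⟩)
  have : CompleteSpace V :=
    (Submodule.isClosed_topologicalClosure _).completeSpace_coe
  have : TopologicalSpace.SeparableSpace V := by
    have h : TopologicalSpace.IsSeparable (V : Set H) := by
      rw [hV, Submodule.topologicalClosure_coe]
      exact (TopologicalSpace.IsSeparable.span (R := ℝ)
        (Set.countable_range x).isSeparable).closure
    exact h.separableSpace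
  have hseq := WeakDual.isSeqCompact_closedBall ℝ V (0 : StrongDual ℝ V) C
  let f : ℕ → WeakDual ℝ V := fun k =>
    StrongDual.toWeakDual (InnerProductSpace.toDual ℝ V ⟨x k, hxV k⟩)
  obtain ⟨a, -, φ, hφ, hlim⟩ := hseq (x := f) (fun k => by
    change InnerProductSpace.toDual ℝ V ⟨x k, hxV k⟩ ∈ Metric.closedBall _ _
    rw [mem_closedBall_zero_iff, LinearIsometryEquiv.norm_map]
    exact hC k)
  set q : V := (InnerProductSpace.toDual ℝ V).symm (WeakDual.toStrongDual a) with hq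
  refine ⟨q, φ, hφ, fun v => ?_⟩
  have h1 := ((WeakDual.eval_continuous (𝕜 := ℝ) (V.orthogonalProjectionOnto v)).tendsto a).comp hlim
  have h2 : ∀ u : V, inner ℝ (u : H) v = inner ℝ u (V.orthogonalProjectionOnto v) := fun u =>
    (Submodule.inner_orthogonalProjectionOnto_eq_of_mem_left u v).symm
  have h3 : inner ℝ (q : H) v = a (V.orthogonalProjectionOnto v) := by
    rw [h2, hq, InnerProductSpace.toDual_symm_apply]
    rfl
  rw [h3]
  refine h1.congr fun k => ?_
  exact (h2 ⟨x (φ k), hxV (φ k)⟩).symm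

variable {H : Type*} [NormedAddCommGroup H] [InnerProductSpace ℝ H]

/-- The demiclosedness principle for isometric operators. -/
theorem IsIsometricOn.eq_of_weaklyConvergesTo {D : Set H} {T : H → H} (hT : IsIsometricOn D T)
    {y : ℕ → H} {p : H} {C : ℝ} (hy : ∀ k, y k ∈ D) (hp : p ∈ D) (hC : ∀ k, ‖y k‖ ≤ C)
    (hw : WeaklyConvergesTo y p) (h0 : Tendsto (fun k => ‖y k - T (y k)‖) atTop (𝓝 0)) :
    T p = p := by
  -- Opial's argument: expand `‖y k - T p‖ ^ 2` around `p` and bound `‖y k - T p‖` by the triangle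
  -- inequality through `T (y k)`; the terms `‖y k - p‖ ^ 2` cancel.
  have hbound : ∀ k, ‖p - T p‖ ^ 2 ≤ ‖y k - T (y k)‖ ^ 2 + 2 * ‖y k - T (y k)‖ * (C + ‖p‖)
      - 2 * (inner ℝ (y k) (p - T p) - inner ℝ p (p - T p)) := by
    intro k
    have h1 : ‖y k - T p‖ ^ 2 = ‖y k - p‖ ^ 2 + 2 * inner ℝ (y k - p) (p - T p)
        + ‖p - T p‖ ^ 2 := by
      rw [← norm_add_sq_real, sub_add_sub_cancel]
    have h2 : ‖y k - T p‖ ≤ ‖y k - T (y k)‖ + ‖y k - p‖ := by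
      rw [← hT _ (hy k) _ hp]
      exact norm_sub_le_norm_sub_add_norm_sub _ _ _
    have h3 : ‖y k - p‖ ≤ C + ‖p‖ := (norm_sub_le _ _).trans (by gcongr; exact hC k)
    have h4 : ‖y k - T p‖ ^ 2 ≤ (‖y k - T (y k)‖ + ‖y k - p‖) ^ 2 := by gcongr
    have h5 := mul_le_mul_of_nonneg_left h3 (norm_nonneg (y k - T (y k)))
    rw [inner_sub_left] at h1
    linarith
  have hlim : Tendsto (fun k => ‖y k - T (y k)‖ ^ 2 + 2 * ‖y k - T (y k)‖ * (C + ‖p‖)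
      - 2 * (inner ℝ (y k) (p - T p) - inner ℝ p (p - T p))) atTop (𝓝 0) := by
    have := ((h0.pow 2).add ((h0.const_mul 2).mul_const (C + ‖p‖))).sub
      (((hw (p - T p)).sub_const (inner ℝ p (p - T p))).const_mul 2)
    simpa using this
  have h : ‖p - T p‖ ^ 2 ≤ 0 := ge_of_tendsto' hlim hbound
  have h' : ‖p - T p‖ = 0 := by nlinarith [norm_nonneg (p - T p)]
  exact (sub_eq_zero.mp (norm_eq_zero.mp h')).symm

/-! ### Circumcenters and common fixed points -/

/-- A circumcenter of `K` is the orthogonal projection onto the affine hull of `K` of any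
point equidistant from the points of `K`. -/
theorem IsCircumcenter.inner_eq_zero {K : Set H} {c z u : H} {s : ℝ} (hc : IsCircumcenter K c)
    (hz : ∀ v ∈ K, ‖v - z‖ = s) (hu : u ∈ K) : inner ℝ (z - c) (u - c) = 0 := by
  obtain ⟨hcK, r, hr⟩ := hc
  have hc' : ∀ v ∈ K, ‖v - c‖ = r := fun v hv => by
    have : ‖c - v‖ ∈ (fun v => ‖c - v‖) '' K := ⟨v, hv, rfl⟩
    rwa [hr, Set.mem_singleton_iff, norm_sub_rev] at this
  -- Both `c` and `z` are equidistant from `v` and `w`; subtracting the two expanded equalities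
  -- leaves this.
  have key : ∀ v ∈ K, ∀ w ∈ K, inner ℝ (z - c) (v - w) = 0 := by
    intro v hv w hw
    have h1 : ‖v - c‖ ^ 2 = ‖w - c‖ ^ 2 := by rw [hc' v hv, hc' w hw]
    have h2 : ‖v - z‖ ^ 2 = ‖w - z‖ ^ 2 := by rw [hz v hv, hz w hw]
    simp only [norm_sub_sq_real] at h1 h2
    rw [inner_sub_right, inner_sub_left, inner_sub_left, real_inner_comm v z, real_inner_comm v c,
      real_inner_comm w z, real_inner_comm w c]
    linarith
  have hmem : u - c ∈ vectorSpan ℝ K := by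
    have := AffineSubspace.vsub_mem_direction (subset_affineSpan ℝ K hu) hcK
    rwa [direction_affineSpan] at this
  have hall : ∀ v ∈ vectorSpan ℝ K, inner ℝ (z - c) v = 0 := by
    intro v hv
    unfold vectorSpan at hv
    induction hv using Submodule.span_induction with
    | mem v hv => obtain ⟨x, hx, y, hy, rfl⟩ := hv; exact key x hx y hy
    | zero => simp
    | add a b _ _ ha hb => rw [inner_add_right, ha, hb, add_zero]
    | smul c a _ ha => rw [inner_smul_right, ha, mul_zero]
  exact hall _ hmem

/-- Compositions of isometric operators preserve the distance to a common fixed point. -/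
theorem norm_composition_sub {D : Set H} {T : ℕ → H → H} {m : ℕ}
    (hT : ∀ i, 1 ≤ i → i ≤ m → IsIsometricOn D (T i)) (hcomp : CompositionsDefinedOn D T m)
    {x z : H} (hx : x ∈ D) (hz : z ∈ ⋂ i ∈ Set.Icc 1 m, fixSet D (T i)) :
    ∀ k ≤ m, ‖composition T k x - z‖ = ‖x - z‖ := by
  intro k
  induction k with
  | zero => intro _; rfl
  | succ k ih =>
    intro hk
    have hzk : z ∈ fixSet D (T (k + 1)) := by
      simp only [Set.mem_iInter] at hz
      exact hz (k + 1) ⟨by omega, hk⟩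
    have hmem : composition T k x ∈ D := by
      rcases Nat.eq_zero_or_pos k with rfl | hpos
      · exact hx
      · exact hcomp k hpos (by omega) x hx
    rw [← ih (by omega), ← hT (k + 1) (by omega) hk _ hmem _ hzk.1, hzk.2]
    rfl

/-- The operators of `S` preserve the distance to common fixed points. -/
theorem norm_op_sub {D : Set H} {T : ℕ → H → H} {m : ℕ} {S : Set (H → H)}
    (hT : ∀ i, 1 ≤ i → i ≤ m → IsIsometricOn D (T i))
    (hS : S = opsSimple T m ∨ (S = opsComposed T m ∧ CompositionsDefinedOn D T m))
    {x z : H} (hx : x ∈ D) (hz : z ∈ ⋂ i ∈ Set.Icc 1 m, fixSet D (T i)) {G : H → H} (hG : G ∈ S) :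
    ‖G x - z‖ = ‖x - z‖ := by
  rcases hS with rfl | ⟨rfl, hcomp⟩
  · rcases hG with rfl | ⟨i, h1, hm, rfl⟩
    · rfl
    · simp only [Set.mem_iInter] at hz
      have hzi := hz i ⟨h1, hm⟩
      rw [← hT i h1 hm x hx z hzi.1, hzi.2]
  · rcases hG with rfl | ⟨k, h1, hm, rfl⟩
    · rfl
    · exact norm_composition_sub hT hcomp hx hz k hm

/-- If the operators of `S` move a point by at most `r`, then each `Tᵢ` moves it by at
most `2 * r`. -/
theorem norm_sub_le_of_forall_op {D : Set H} {T : ℕ → H → H} {m : ℕ} {S : Set (H → H)}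
    (hT : ∀ i, 1 ≤ i → i ≤ m → IsIsometricOn D (T i))
    (hS : S = opsSimple T m ∨ (S = opsComposed T m ∧ CompositionsDefinedOn D T m))
    {x : H} (hx : x ∈ D) {r : ℝ} (hr : ∀ G ∈ S, ‖x - G x‖ ≤ r) {i : ℕ} (hi : 1 ≤ i)
    (him : i ≤ m) : ‖x - T i x‖ ≤ 2 * r := by
  rcases hS with rfl | ⟨rfl, hcomp⟩
  · have h := hr (T i) (Or.inr ⟨i, hi, him, rfl⟩)
    linarith [norm_nonneg (x - T i x)]
  · obtain ⟨k, rfl⟩ : ∃ k, i = k + 1 := ⟨i - 1, by omega⟩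
    have hk : composition T k x ∈ D ∧ ‖x - composition T k x‖ ≤ r := by
      rcases Nat.eq_zero_or_pos k with rfl | hpos
      · exact ⟨hx, hr id (Or.inl rfl)⟩
      · exact ⟨hcomp k hpos (by omega) x hx, hr _ (Or.inr ⟨k, hpos, by omega, rfl⟩)⟩
    have h1 : ‖x - composition T (k + 1) x‖ ≤ r := hr _ (Or.inr ⟨k + 1, hi, him, rfl⟩)
    -- `T (k + 1)` carries `composition T k x` and `x` to these two points, so the second leg of the
    -- triangle is also at most `r`.
    have h2 : ‖composition T (k + 1) x - T (k + 1) x‖ = ‖x - composition T k x‖ := by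
      rw [norm_sub_rev x]
      exact hT _ hi him _ hk.1 _ hx
    linarith [norm_sub_le_norm_sub_add_norm_sub x (composition T (k + 1) x) (T (k + 1) x), hk.2]

/-! ### Projections and convergence criteria -/

/-- A point `p` of `C` with `x - p` orthogonal to `C - p` is the projection of `x` onto `C`. -/
theorem isProjection_of_inner_eq_zero {C : Set H} {x p : H} (hp : p ∈ C)
    (h : ∀ z ∈ C, inner ℝ (x - p) (z - p) = 0) : IsProjection C x p := by
  refine ⟨hp, fun y hy hne => lt_of_pow_lt_pow_left₀ 2 (norm_nonneg _) ?_⟩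
  have h1 : ‖x - y‖ ^ 2 = ‖x - p‖ ^ 2 - 2 * inner ℝ (x - p) (y - p) + ‖y - p‖ ^ 2 := by
    rw [← norm_sub_sq_real, sub_sub_sub_cancel_right]
  have h2 : 0 < ‖y - p‖ := norm_pos_iff.mpr (sub_ne_zero.mpr hne)
  rw [h1, h y hy]
  nlinarith

/-- If every subsequence of a bounded sequence has all its weak limits equal to `p`, the
sequence converges weakly to `p`. -/
theorem WeaklyConvergesTo.of_subseq [CompleteSpace H] {x : ℕ → H} {p : H} {C : ℝ}
    (hC : ∀ k, ‖x k‖ ≤ C)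
    (h : ∀ (q : H) (φ : ℕ → ℕ), Tendsto φ atTop atTop → WeaklyConvergesTo (x ∘ φ) q → q = p) :
    WeaklyConvergesTo x p := by
  intro v
  refine tendsto_of_subseq_tendsto fun ns hns => ?_
  obtain ⟨q, φ, hφ, hq⟩ := exists_subseq_weaklyConvergesTo (x ∘ ns) C (fun k => hC _)
  obtain rfl := h q (ns ∘ φ) (hns.comp hφ.tendsto_atTop) hq
  exact ⟨φ, hq v⟩

/-- Weak convergence together with `limsup ‖xₖ‖ ≤ ‖p‖` implies convergence in norm. -/
theorem WeaklyConvergesTo.tendsto_of_limsup_le {x : ℕ → H} {p : H} (h : WeaklyConvergesTo x p)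
    (hlim : limsup (fun k => ((‖x k‖ : ℝ) : EReal)) atTop ≤ ((‖p‖ : ℝ) : EReal)) :
    Tendsto x atTop (𝓝 p) := by
  rw [tendsto_iff_norm_sub_tendsto_zero, Metric.tendsto_atTop']
  have hev : ∀ ε > 0, ∀ᶠ k in atTop, ‖x k‖ < ‖p‖ + ε := by
    intro ε hε
    have h1 : limsup (fun k => ((‖x k‖ : ℝ) : EReal)) atTop < ((‖p‖ + ε : ℝ) : EReal) :=
      hlim.trans_lt (EReal.coe_lt_coe_iff.mpr (by linarith))
    exact (eventually_lt_of_limsup_lt h1).mono fun k hk => EReal.coe_lt_coe_iff.mp hk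
  intro ε hε
  set b := ‖p‖
  have hb : 0 ≤ b := norm_nonneg p
  -- The left side bounds `‖x k‖ ^ 2 - 2 * ⟪x k, p⟫ + b ^ 2` once `‖x k‖ < b + δ` and `⟪x k, p⟫ > b
  -- ^ 2 - δ`.
  obtain ⟨δ, hδ, hδε⟩ : ∃ δ > 0, (b + δ) ^ 2 - b ^ 2 + 2 * δ < ε ^ 2 := by
    have hc : Tendsto (fun δ : ℝ => (b + δ) ^ 2 - b ^ 2 + 2 * δ) (𝓝[>] 0) (𝓝 0) := by
      have : Continuous (fun δ : ℝ => (b + δ) ^ 2 - b ^ 2 + 2 * δ) := by fun_prop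
      simpa using (this.tendsto 0).mono_left nhdsWithin_le_nhds
    obtain ⟨δ, h1, h2⟩ :=
      ((hc.eventually (gt_mem_nhds (pow_pos hε 2))).and self_mem_nhdsWithin).exists
    exact ⟨δ, h2, h1⟩
  have hin : ∀ᶠ k in atTop, b ^ 2 - δ < inner ℝ (x k) p := by
    refine (h p).eventually (lt_mem_nhds ?_)
    rw [real_inner_self_eq_norm_sq]
    linarith
  obtain ⟨N, hN⟩ := eventually_atTop.mp (hin.and (hev δ hδ))
  refine ⟨N, fun k hk => ?_⟩
  obtain ⟨h1, h2⟩ := hN k hk.le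
  rw [Real.dist_eq, sub_zero, abs_norm]
  refine lt_of_pow_lt_pow_left₀ 2 hε.le ?_
  rw [norm_sub_sq_real]
  have h3 : ‖x k‖ ^ 2 ≤ (b + δ) ^ 2 := by gcongr
  linarith

/-- In finite dimension weak convergence is convergence in norm. -/
theorem WeaklyConvergesTo.tendsto_of_finiteDimensional [FiniteDimensional ℝ H] {x : ℕ → H} {p : H}
    (h : WeaklyConvergesTo x p) : Tendsto x atTop (𝓝 p) := by
  let b := stdOrthonormalBasis ℝ H
  have hsum : Tendsto (fun k => ∑ i, inner ℝ (x k) (b i) • b i) atTop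
      (𝓝 (∑ i, inner ℝ p (b i) • b i)) :=
    tendsto_finsetSum _ fun i _ => (h (b i)).smul_const (b i)
  have hrepr : ∀ u : H, ∑ i, inner ℝ u (b i) • b i = u := fun u => by
    simpa only [real_inner_comm] using b.sum_repr' u
  simpa only [hrepr] using hsum

end CircumcenterMethod

/-! ### The main theorem -/

open CircumcenterMethod in
theorem mainTheorem11 {H : Type*} [NormedAddCommGroup H] [InnerProductSpace ℝ H] [CompleteSpace H]
    (D : Set H) (hD : D.Nonempty) (hDclosed : CircumcenterMethod.IsWeaklySeqClosed D)
    (m : ℕ) (hm : 1 ≤ m) (T : ℕ → H → H)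
    (hT : ∀ i, 1 ≤ i → i ≤ m → CircumcenterMethod.IsIsometricOn D (T i))
    (hFix : (⋂ i ∈ Set.Icc 1 m, CircumcenterMethod.fixSet D (T i)).Nonempty)
    (S : Set (H → H))
    (hS : S = CircumcenterMethod.opsSimple T m ∨
      (S = CircumcenterMethod.opsComposed T m ∧ CircumcenterMethod.CompositionsDefinedOn D T m))
    (hproper : CircumcenterMethod.IsProperOver S D) (x : D) :
    ∃ p : H,
      CircumcenterMethod.IsProjection (⋂ i ∈ Set.Icc 1 m, CircumcenterMethod.fixSet D (T i)) x p ∧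
      (∀ k : ℕ, k ≠ 0 →
        CircumcenterMethod.IsProjection (⋂ i ∈ Set.Icc 1 m, CircumcenterMethod.fixSet D (T i))
          (hproper.selfMap^[k] x) p) ∧
      CircumcenterMethod.WeaklyConvergesTo (fun k => (hproper.selfMap^[k] x : H)) p ∧
      ((limsup (fun k => ((‖(hproper.selfMap^[k] x : H)‖ : ℝ) : EReal)) atTop ≤ ((‖p‖ : ℝ) : EReal) ∨
          FiniteDimensional ℝ H) →
        Tendsto (fun k => (hproper.selfMap^[k] x : H)) atTop (𝓝 p)) := by
  set F := ⋂ i ∈ Set.Icc 1 m, CircumcenterMethod.fixSet D (T i) with hF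
  have hid : id ∈ S := by
    rcases hS with rfl | ⟨rfl, -⟩ <;> exact Or.inl rfl
  set y : ℕ → H := fun k => (hproper.selfMap^[k] x : H) with hy
  have hyD : ∀ k, y k ∈ D := fun k => (hproper.selfMap^[k] x).2
  have hcirc : ∀ k, IsCircumcenter ((fun G => G (y k)) '' S) (y (k + 1)) := fun k => by
    have h := hproper.selfMap_spec (hproper.selfMap^[k] x)
    rw [← Function.iterate_succ_apply' (f := hproper.selfMap)] at h
    exact circumcenter_eq_some_iff.mp h
  have horth : ∀ k, ∀ z ∈ F, inner ℝ (z - y (k + 1)) (y k - y (k + 1)) = 0 := by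
    intro k z hz
    refine (hcirc k).inner_eq_zero (s := ‖y k - z‖) ?_ ⟨id, hid, rfl⟩
    rintro _ ⟨G, hG, rfl⟩
    exact norm_op_sub hT hS (hyD k) hz hG
  have hpyth : ∀ k, ∀ z ∈ F,
      ‖y k - z‖ ^ 2 = ‖y (k + 1) - z‖ ^ 2 + ‖y k - y (k + 1)‖ ^ 2 := by
    intro k z hz
    have h : ‖y k - z‖ ^ 2 = ‖(z - y (k + 1)) - (y k - y (k + 1))‖ ^ 2 := by
      rw [sub_sub_sub_cancel_right, norm_sub_rev]
    rw [h, norm_sub_sq_real, horth k z hz, norm_sub_rev z]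
    ring
  obtain ⟨z₀, hz₀⟩ := hFix
  have hanti : Antitone fun k => ‖y k - z₀‖ ^ 2 := antitone_nat_of_succ_le fun k => by
    rw [hpyth k z₀ hz₀]
    linarith [sq_nonneg ‖y k - y (k + 1)‖]
  have hC : ∀ k, ‖y k‖ ≤ ‖y 0 - z₀‖ + ‖z₀‖ := fun k => by
    have h1 : ‖y k - z₀‖ ≤ ‖y 0 - z₀‖ :=
      le_of_sq_le_sq (hanti (Nat.zero_le k)) (norm_nonneg _)
    linarith [norm_le_norm_sub_add (y k) z₀]
  -- The squared steps are consecutive differences of the convergent sequence `‖y k - z₀‖ ^ 2`.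
  have hstep : Tendsto (fun k => ‖y k - y (k + 1)‖) atTop (𝓝 0) := by
    have hlim := tendsto_atTop_ciInf hanti ⟨0, by rintro _ ⟨k, rfl⟩; exact sq_nonneg _⟩
    have h1 := hlim.sub (hlim.comp (tendsto_add_atTop_nat 1))
    rw [sub_self] at h1
    have h2 : Tendsto (fun k => ‖y k - y (k + 1)‖ ^ 2) atTop (𝓝 0) := h1.congr fun k => by
      simp only [Function.comp_apply]
      linarith [hpyth k z₀ hz₀]
    simpa using h2.sqrt
  have hfixlim : ∀ i, 1 ≤ i → i ≤ m → Tendsto (fun k => ‖y k - T i (y k)‖) atTop (𝓝 0) := by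
    intro i hi him
    -- Inner factor: `y k` and `G (y k)` are both one circumradius from `y (k + 1)`. Outer factor:
    -- passing from `S` to the single operator `T i`.
    have hle : ∀ k, ‖y k - T i (y k)‖ ≤ 2 * (2 * ‖y k - y (k + 1)‖) := fun k => by
      refine norm_sub_le_of_forall_op hT hS (hyD k) (fun G hG => ?_) hi him
      obtain ⟨-, r, hr⟩ := hcirc k
      have hdist : ∀ G ∈ S, ‖y (k + 1) - G (y k)‖ = r := fun G hG => by
        have : ‖y (k + 1) - G (y k)‖ ∈ (fun v => ‖y (k + 1) - v‖) '' ((fun G => G (y k)) '' S) :=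
          ⟨_, ⟨G, hG, rfl⟩, rfl⟩
        rwa [hr] at this
      have h1 : ‖y (k + 1) - y k‖ = r := hdist id hid
      have h2 := norm_sub_le_norm_sub_add_norm_sub (y k) (y (k + 1)) (G (y k))
      rw [hdist G hG, ← h1, norm_sub_rev (y (k + 1))] at h2
      linarith
    refine squeeze_zero (fun k => norm_nonneg _) hle ?_
    simpa using (hstep.const_mul 2).const_mul 2
  have hinner : ∀ k, ∀ z ∈ F, ∀ w ∈ F, inner ℝ (y k) (z - w) = inner ℝ (y 0) (z - w) := by
    intro k z hz w hw
    induction k with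
    | zero => rfl
    | succ k ih =>
      rw [← ih]
      have h1 := horth k z hz
      have h2 := horth k w hw
      have h3 : inner ℝ (y k - y (k + 1)) (z - w) = 0 := by
        rw [real_inner_comm, ← sub_sub_sub_cancel_right z w (y (k + 1)), inner_sub_left, h1, h2,
          sub_zero]
      rw [inner_sub_left] at h3
      linarith
  have hcluster : ∀ (q : H) (φ : ℕ → ℕ), Tendsto φ atTop atTop → WeaklyConvergesTo (y ∘ φ) q →
      q ∈ F ∧ ∀ z ∈ F, ∀ w ∈ F, inner ℝ q (z - w) = inner ℝ (y 0) (z - w) := by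
    intro q φ hφ hq
    have hqD : q ∈ D := hDclosed _ q (fun k => hyD (φ k)) hq
    refine ⟨?_, fun z hz w hw => ?_⟩
    · simp only [hF, Set.mem_iInter]
      rintro i ⟨hi, him⟩
      exact ⟨hqD, (hT i hi him).eq_of_weaklyConvergesTo (y := y ∘ φ) (fun k => hyD _) hqD
        (fun k => hC _) hq ((hfixlim i hi him).comp hφ)⟩
    · refine tendsto_nhds_unique (hq (z - w)) ?_
      simp only [Function.comp_apply, hinner _ z hz w hw]
      exact tendsto_const_nhds
  obtain ⟨p, φ, hφ, hp⟩ := exists_subseq_weaklyConvergesTo y _ hC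
  obtain ⟨hpF, hpin⟩ := hcluster p φ hφ.tendsto_atTop hp
  have hproj : ∀ k, IsProjection F (y k) p := fun k =>
    isProjection_of_inner_eq_zero hpF fun z hz => by
      rw [inner_sub_left, hinner k z hz p hpF, hpin z hz p hpF, sub_self]
  have hweak : WeaklyConvergesTo y p := .of_subseq hC fun q ψ hψ hq => by
    obtain ⟨hqF, hqin⟩ := hcluster q ψ hψ hq
    -- Two cluster points `p, q ∈ F` have the same inner product with `q - p`, namely that of `y 0`.
    have h : inner ℝ (q - p) (q - p) = 0 := by
      rw [inner_sub_left, hqin q hqF p hpF, hpin q hqF p hpF, sub_self]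
    exact sub_eq_zero.mp (inner_self_eq_zero.mp h)
  refine ⟨p, hproj 0, fun k _ => hproj k, hweak, ?_⟩
  rintro (hlim | hfin)
  · exact hweak.tendsto_of_limsup_le hlim
  · exact hweak.tendsto_of_finiteDimensional
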